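/- Let $G_1(u)=\sum_{k\ge 1}a_k u^k$ and $G_2(u)=\sum_{k\ge 1}b_k u^{k+1}$ be formal power series with real coefficients such that the product $G_1(u)G_2(u)$ is not identically zero (equivalently, $G_1\not\equiv 0$ and $G_2\not\equiv 0$). Consider the planar formal system $$\dot u = v+G_2(u),\qquad \dot v = 2\,v\,G_1(u),$$ with associated formal vector field $\mathbf P(u,v)=(v+G_2(u),\,2vG_1(u))^T$. Then this system has no formal inverse integrating factor of the form $V=v+\cdots$; that is, there is no formal power series $V\in\mathbb R[[u,v]]$ of the form $V = v + (\text{terms of total degree at least } 2 \text{ in } (u,v))$ such that $$\nabla V\cdot \mathbf P = \operatorname{div}(\mathbf P)\,V .$$ -/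

import Mathlib

/-- A formal vector field `F = (F_i)` in the variables indexed by `σ`, with real coefficients:
every component is a formal power series. -/
abbrev FormalVectorField (σ : Type*) := σ → MvPowerSeries σ ℝ

namespace FormalVectorField

variable {σ : Type*} [Fintype σ]

/-- The divergence `∑ ∂F_i/∂x_i`. -/
noncomputable def divergence (F : FormalVectorField σ) : MvPowerSeries σ ℝ :=
  ∑ i, MvPowerSeries.pderiv ℝ i (F i)

/-- The Lie derivative `∇V · F = ∑ (∂V/∂x_i) F_i`. -/
noncomputable def lieDerivative (F : FormalVectorField σ) (V : MvPowerSeries σ ℝ) :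
    MvPowerSeries σ ℝ :=
  ∑ i, MvPowerSeries.pderiv ℝ i V * F i

/-- `V` is a formal inverse Jacobi multiplier of `F` (for planar fields: a formal inverse
integrating factor): `∇V · F = div(F) V`. -/
def IsInverseIntegratingFactor (F : FormalVectorField σ) (V : MvPowerSeries σ ℝ) : Prop :=
  F.lieDerivative V = F.divergence * V

end FormalVectorField

/-- The coordinate `u` of the plane, as a formal power series in `(u, v)`. -/
noncomputable abbrev coordU : MvPowerSeries (Fin 2) ℝ := MvPowerSeries.X 0

/-- The coordinate `v` of the plane, as a formal power series in `(u, v)`. -/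
noncomputable abbrev coordV : MvPowerSeries (Fin 2) ℝ := MvPowerSeries.X 1

/-- The planar formal vector field `P(u, v) = (v + G₂(u), 2 v G₁(u))`. -/
noncomputable def planarField (G₁ G₂ : PowerSeries ℝ) : FormalVectorField (Fin 2) :=
  ![coordV + G₂.subst coordU, 2 * coordV * G₁.subst coordU]

/-- `V = v + ⋯`, where the dots stand for terms of total degree at least two in `(u, v)`. -/
def HasLeadingTermV (V : MvPowerSeries (Fin 2) ℝ) : Prop :=
  2 ≤ (V - coordV).order

/-!
Write `θ = u d/du` and `W(G, T) = G θT - θG T`. If `V = ∑ U_k(u) v ^ k` is an inverse integrating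
factor then, with `A = 2 u G₁` and `G = G₂`, comparing powers of `v` gives `W(G, U_0) = A U_0` and
`W(G, U_{k+1}) = -θ U_k - k A U_{k+1}`. The operator `W(G, ·)` kills the multiples of `G`, and it
adds `ord G` to the order of every series whose order is not `ord G`. If `U_1(0) ≠ 0`, then `U_0`
has order `ord A` modulo the span of `1` and `G`, and this reduced order drops by `ord G ≥ 1` from
each `U_k` to the next while staying positive, which is absurd.
-/

section EulerDerivation

open PowerSeries

/-- The Euler operator `X d/dX`. Unlike `d/dX` it preserves the order of every power series without
constant term, so no truncated subtraction enters the order counts. -/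
noncomputable def eulerDerivation (R : Type*) [CommSemiring R] : Derivation R R⟦X⟧ R⟦X⟧ :=
  (X : R⟦X⟧) • derivative R

section CommSemiring

variable {R : Type*} [CommSemiring R]

theorem eulerDerivation_apply (f : R⟦X⟧) : eulerDerivation R f = X * derivative R f :=
  rfl

theorem coeff_eulerDerivation (f : R⟦X⟧) (n : ℕ) :
    coeff n (eulerDerivation R f) = n * coeff n f := by
  cases n with
  | zero => simp [eulerDerivation_apply]
  | succ n =>
    rw [eulerDerivation_apply, coeff_succ_X_mul, coeff_derivative, mul_comm, Nat.cast_succ]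

theorem constantCoeff_eulerDerivation (f : R⟦X⟧) :
    constantCoeff (eulerDerivation R f) = 0 := by
  simp [eulerDerivation_apply]

theorem eulerDerivation_C (c : R) : eulerDerivation R (C c) = 0 := by
  simp [eulerDerivation_apply]

theorem eulerDerivation_C_mul (c : R) (f : R⟦X⟧) :
    eulerDerivation R (C c * f) = C c * eulerDerivation R f := by
  simp [Derivation.leibniz, eulerDerivation_C]

theorem eulerDerivation_X_pow_mul (n : ℕ) (f : R⟦X⟧) :
    eulerDerivation R (X ^ n * f) = X ^ n * ((n : R⟦X⟧) * f + eulerDerivation R f) := by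
  cases n with
  | zero => simp
  | succ n =>
    simp only [eulerDerivation_apply, Derivation.leibniz, Derivation.leibniz_pow, derivative_X,
      smul_eq_mul, nsmul_eq_mul, Nat.add_sub_cancel]
    ring

theorem exists_eq_X_pow_mul_of_order_eq {f : R⟦X⟧} {n : ℕ} (hf : f.order = n) :
    ∃ g : R⟦X⟧, constantCoeff g ≠ 0 ∧ f = X ^ n * g := by
  have hn : f.order.toNat = n := by simp [hf]
  refine ⟨divXPowOrder f, ?_, by rw [← hn, X_pow_order_mul_divXPowOrder]⟩
  rw [constantCoeff_divXPowOrder, hn]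
  exact (order_eq_nat.mp hf).1

theorem order_eulerDerivation [NoZeroDivisors R] [CharZero R] {f : R⟦X⟧}
    (hf : constantCoeff f = 0) : (eulerDerivation R f).order = f.order := by
  refine le_antisymm (le_order _ _ fun i hi => ?_) (le_order _ _ fun i hi => ?_)
  · have := coeff_of_lt_order i hi
    rw [coeff_eulerDerivation, mul_eq_zero, Nat.cast_eq_zero] at this
    rcases this with rfl | h
    · simpa using hf
    · exact h
  · rw [coeff_eulerDerivation, coeff_of_lt_order i hi, mul_zero]

end CommSemiring

/-- The Wronskian of two power series with respect to the Euler operator instead of `d/dX`. -/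
noncomputable def eulerWronskian {R : Type*} [CommRing R] (f g : R⟦X⟧) : R⟦X⟧ :=
  f * eulerDerivation R g - eulerDerivation R f * g

section CommRing

variable {R : Type*} [CommRing R]

theorem eulerWronskian_sub_C (f g : R⟦X⟧) (c : R) :
    eulerWronskian f (g - C c) = eulerWronskian f g + C c * eulerDerivation R f := by
  simp only [eulerWronskian, map_sub, eulerDerivation_C]
  ring

theorem eulerWronskian_sub_C_mul_self (f g : R⟦X⟧) (c : R) :
    eulerWronskian f (g - C c * f) = eulerWronskian f g := by
  simp only [eulerWronskian, map_sub, eulerDerivation_C_mul]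
  ring

theorem eulerWronskian_zero_right (f : R⟦X⟧) : eulerWronskian f 0 = 0 := by
  simp [eulerWronskian]

theorem order_eulerWronskian [NoZeroDivisors R] [CharZero R] {f g : R⟦X⟧} {m n : ℕ}
    (hf : f.order = m) (hg : g.order = n) (hmn : m ≠ n) :
    (eulerWronskian f g).order = (m + n : ℕ) := by
  obtain ⟨a, ha, rfl⟩ := exists_eq_X_pow_mul_of_order_eq hf
  obtain ⟨b, hb, rfl⟩ := exists_eq_X_pow_mul_of_order_eq hg
  set c := ((n : R⟦X⟧) - m) * (a * b) + (a * eulerDerivation R b - eulerDerivation R a * b) with hc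
  have hfactor : eulerWronskian (X ^ m * a) (X ^ n * b) = X ^ (m + n) * c := by
    simp only [eulerWronskian, eulerDerivation_X_pow_mul, hc]
    ring
  have hc₀ : constantCoeff c ≠ 0 := by
    have hnm : (n : R) - m ≠ 0 := sub_ne_zero.mpr (by exact_mod_cast hmn.symm)
    simpa [hc, constantCoeff_eulerDerivation] using ⟨hnm, ha, hb⟩
  have hc_order : c.order = 0 :=
    not_ne_iff.mp (order_ne_zero_iff_constCoeff_eq_zero.not.mpr hc₀)
  rw [hfactor, order_mul, order_X_pow, hc_order, add_zero]

end CommRing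

variable {K : Type*} [Field K] [CharZero K]

theorem exists_order_sub_C_mul_of_order_eulerWronskian {f g : K⟦X⟧} {n q : ℕ} (hf : f.order = n)
    (hfg : (eulerWronskian f g).order = q) :
    ∃ (c : K) (j : ℕ), (g - C c * f).order = j ∧ j ≠ n ∧ q = n + j := by
  have hfn : coeff n f ≠ 0 := (order_eq_nat.mp hf).1
  set c := coeff n g / coeff n f with hc
  have hW : (eulerWronskian f (g - C c * f)).order = q := by
    rw [eulerWronskian_sub_C_mul_self, hfg]
  have hne : g - C c * f ≠ 0 := by
    intro h
    simp [h, eulerWronskian_zero_right] at hW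
  obtain ⟨j, hj⟩ : ∃ j : ℕ, (g - C c * f).order = j := ⟨_, (coe_toNat_order hne).symm⟩
  have hjn : j ≠ n := by
    rintro rfl
    apply (order_eq_nat.mp hj).1
    rw [map_sub, coeff_C_mul, hc, div_mul_cancel₀ _ hfn, sub_self]
  refine ⟨c, j, hj, hjn, ?_⟩
  rw [order_eulerWronskian hf hj hjn.symm] at hW
  exact_mod_cast hW.symm

/-- `T` has order `q` modulo the span of `1` and `G`: some `T - a - c G` with `a`, `c` constant has
order `q`, where `q` is different from the orders `0` and `ord G` of `1` and `G`, so that no further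
multiple of these can be removed. -/
def HasOrderModSpan (G T : K⟦X⟧) (q : ℕ) : Prop :=
  q ≠ 0 ∧ G.order ≠ q ∧ ∃ a c : K, (T - C a - C c * G).order = q

theorem HasOrderModSpan.exists_of_eulerWronskian {G T T' B : K⟦X⟧} {n q : ℕ} (hG : G.order = n)
    (hT : HasOrderModSpan G T q) (hB : q < B.order)
    (h : eulerWronskian G T' = -eulerDerivation K T - B) :
    ∃ q', HasOrderModSpan G T' q' ∧ q = n + q' := by
  obtain ⟨hq₀, hqG, a, c, hS⟩ := hT
  set S := T - C a - C c * G with hS_def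
  have hθS : (-eulerDerivation K S).order = q := by
    rw [order_neg, order_eulerDerivation, hS]
    exact order_ne_zero_iff_constCoeff_eq_zero.mp (by rw [hS]; exact_mod_cast hq₀)
  have hW : (eulerWronskian G (T' - C c)).order = q := by
    have hsplit : eulerWronskian G (T' - C c) = -eulerDerivation K S + -B := by
      rw [eulerWronskian_sub_C, h, hS_def, map_sub, map_sub, eulerDerivation_C,
        eulerDerivation_C_mul]
      ring
    have hlt : (-eulerDerivation K S).order < (-B).order := by rwa [hθS, order_neg]
    rw [hsplit, order_add_of_order_ne _ _ hlt.ne, inf_eq_left.mpr hlt.le, hθS]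
  obtain ⟨d, j, hj, hjn, hqj⟩ := exists_order_sub_C_mul_of_order_eulerWronskian hG hW
  rw [hG, Ne, Nat.cast_inj] at hqG
  exact ⟨j, ⟨by omega, by rw [hG]; exact_mod_cast hjn.symm, c, d, hj⟩, hqj⟩

/-- The equations for the coefficients `U k` of `v ^ k` of an inverse integrating factor of
`(v + G(u), 2 v G₁(u))`, multiplied by `u` and with `2 u G₁` replaced by an arbitrary `A`. -/
structure IsSliceSolution (A G : K⟦X⟧) (U : ℕ → K⟦X⟧) : Prop where
  zero : eulerWronskian G (U 0) = A * U 0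
  succ (k : ℕ) : eulerWronskian G (U (k + 1)) = -eulerDerivation K (U k) - k * A * U (k + 1)

namespace IsSliceSolution

variable {A G : K⟦X⟧} {U : ℕ → K⟦X⟧}

theorem order_zero (hU : IsSliceSolution A G U) {n : ℕ} (hG : G.order = n) (hn : n ≠ 0)
    (hU₀ : constantCoeff (U 0) = 0) (hU₁ : constantCoeff (U 1) ≠ 0) : (U 0).order = n := by
  have hU₁_order : (U 1).order = (0 : ℕ) :=
    not_ne_iff.mp (order_ne_zero_iff_constCoeff_eq_zero.not.mpr hU₁)
  have hW : eulerWronskian G (U 1) = -eulerDerivation K (U 0) := by simpa using hU.succ 0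
  rw [← order_eulerDerivation hU₀, ← order_neg, ← hW, order_eulerWronskian hG hU₁_order hn,
    add_zero]

theorem hasOrderModSpan_zero (hU : IsSliceSolution A G U) {n p : ℕ} (hG : G.order = n)
    (hn : n ≠ 0) (hA : A.order = p) (hU₀ : constantCoeff (U 0) = 0)
    (hU₁ : constantCoeff (U 1) ≠ 0) : HasOrderModSpan G (U 0) p := by
  have hW : (eulerWronskian G (U 0)).order = (p + n : ℕ) := by
    rw [hU.zero, order_mul, hA, hU.order_zero hG hn hU₀ hU₁, Nat.cast_add]
  obtain ⟨c, j, hj, hjn, hpj⟩ := exists_order_sub_C_mul_of_order_eulerWronskian hG hW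
  obtain rfl : p = j := by omega
  have hG₀ : constantCoeff G = 0 :=
    order_ne_zero_iff_constCoeff_eq_zero.mp (by rw [hG]; exact_mod_cast hn)
  have hp : (p : ℕ∞) ≠ 0 := by
    rw [← hj]
    exact order_ne_zero_iff_constCoeff_eq_zero.mpr (by simp [hG₀, hU₀])
  exact ⟨by exact_mod_cast hp, by rw [hG]; exact_mod_cast hjn.symm, 0, c,
    by rwa [map_zero, sub_zero]⟩

theorem exists_hasOrderModSpan (hU : IsSliceSolution A G U) {n p : ℕ} (hG : G.order = n)
    (hn : n ≠ 0) (hA : A.order = p) (hU₀ : constantCoeff (U 0) = 0)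
    (hU₁ : constantCoeff (U 1) ≠ 0) (k : ℕ) : ∃ q, HasOrderModSpan G (U k) q ∧ p = n * k + q := by
  induction k with
  | zero => exact ⟨p, hU.hasOrderModSpan_zero hG hn hA hU₀ hU₁, by simp⟩
  | succ k ih =>
    obtain ⟨q, hq, hpq⟩ := ih
    have hlt : q < (k * A * U (k + 1)).order := by
      rcases Nat.eq_zero_or_pos k with rfl | hk
      · simp
      have hqp : q < p := by
        have := Nat.mul_pos (Nat.pos_of_ne_zero hn) hk
        omega
      calc (q : ℕ∞) < A.order := by rw [hA]; exact_mod_cast hqp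
        _ ≤ (k * A * U (k + 1)).order := by
          rw [order_mul _ (U (k + 1)), order_mul _ A]
          exact le_add_self.trans le_self_add
    obtain ⟨q', hq', rfl⟩ := hq.exists_of_eulerWronskian hG hlt (hU.succ k)
    exact ⟨q', hq', by rw [hpq]; ring⟩

theorem constantCoeff_one_eq_zero (hU : IsSliceSolution A G U) (hA : A ≠ 0) (hG : G ≠ 0)
    (hG₀ : constantCoeff G = 0) (hU₀ : constantCoeff (U 0) = 0) :
    constantCoeff (U 1) = 0 := by
  by_contra hU₁
  obtain ⟨p, hp⟩ : ∃ p : ℕ, A.order = p := ⟨_, (coe_toNat_order hA).symm⟩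
  obtain ⟨n, hn⟩ : ∃ n : ℕ, G.order = n := ⟨_, (coe_toNat_order hG).symm⟩
  have hn₀ : n ≠ 0 := by
    have := order_ne_zero_iff_constCoeff_eq_zero.mpr hG₀
    rw [hn] at this
    exact_mod_cast this
  obtain ⟨q, ⟨hq₀, -⟩, hpq⟩ := hU.exists_hasOrderModSpan hn hn₀ hp hU₀ hU₁ p
  have := Nat.le_mul_of_pos_left p (Nat.pos_of_ne_zero hn₀)
  omega

end IsSliceSolution

end EulerDerivation

section Slices

open MvPowerSeries Finsupp

/-- The coefficient of `v ^ k` in a power series in `(u, v)`, as a power series in `u`; here `u` is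
the variable `0` and `v` the variable `1`. -/
noncomputable def slice {R : Type*} [CommSemiring R] (k : ℕ) :
    MvPowerSeries (Fin 2) R →ₗ[R] PowerSeries R where
  toFun V := PowerSeries.mk fun i => coeff (single 0 i + single 1 k) V
  map_add' V W := by ext; simp
  map_smul' c V := by ext; simp

section CommSemiring

variable {R : Type*} [CommSemiring R]

theorem coeff_slice (k i : ℕ) (V : MvPowerSeries (Fin 2) R) :
    PowerSeries.coeff i (slice k V) = coeff (single 0 i + single 1 k) V := by
  simp [slice]

theorem coeff_coeff_finSuccEquiv_eq_coeff_slice (k i : ℕ) (V : MvPowerSeries (Fin 2) R) :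
    coeff (single 0 k) (PowerSeries.coeff i (finSuccEquiv R 1 V)) =
      PowerSeries.coeff i (slice k V) := by
  rw [coeff_coeff_finSuccEquiv, coeff_slice]
  congr 2
  ext j
  fin_cases j <;> simp [Finsupp.cons]

theorem slice_pderiv_zero (k : ℕ) (V : MvPowerSeries (Fin 2) R) :
    slice k (pderiv R 0 V) = PowerSeries.derivative R (slice k V) := by
  ext i
  rw [coeff_slice, coeff_pderiv, PowerSeries.coeff_derivative, coeff_slice, add_right_comm,
    ← single_add]
  simp

theorem slice_zero_X_one_mul (V : MvPowerSeries (Fin 2) R) : slice 0 (X 1 * V) = 0 := by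
  classical
  ext i
  rw [coeff_slice, X, coeff_monomial_mul, if_neg, map_zero]
  intro hle
  simpa using hle 1

theorem slice_succ_X_one_mul (k : ℕ) (V : MvPowerSeries (Fin 2) R) :
    slice (k + 1) (X 1 * V) = slice k V := by
  ext i
  rw [coeff_slice, coeff_slice, single_add, ← add_assoc, add_comm _ (single 1 1), X,
    coeff_add_monomial_mul, one_mul]

theorem slice_X_one_mul_pderiv_one (k : ℕ) (V : MvPowerSeries (Fin 2) R) :
    slice k (X 1 * pderiv R 1 V) = (k : PowerSeries R) * slice k V := by
  cases k with
  | zero => simp [slice_zero_X_one_mul]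
  | succ k =>
    rw [slice_succ_X_one_mul]
    ext i
    rw [coeff_slice, coeff_pderiv, add_assoc, ← single_add, ← nsmul_eq_mul, map_nsmul, coeff_slice,
      nsmul_eq_mul, mul_comm]
    simp

end CommSemiring

section SubstX

variable {σ R : Type*} [CommRing R]

theorem coeff_subst_X [DecidableEq σ] (i : σ) (G : PowerSeries R) (m : σ →₀ ℕ) :
    coeff m (G.subst (X i : MvPowerSeries σ R)) =
      if m = single i (m i) then PowerSeries.coeff (m i) G else 0 := by
  rw [PowerSeries.coeff_subst (PowerSeries.HasSubst.X i), finsum_eq_single _ (m i)]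
  · simp [coeff_X_pow]
  · intro d hd
    have hm : m ≠ single i d := by
      rintro rfl
      simp at hd
    simp [coeff_X_pow, hm]

theorem pderiv_subst_X_self (i : σ) (G : PowerSeries R) :
    pderiv R i (G.subst (X i : MvPowerSeries σ R)) =
      (PowerSeries.derivative R G).subst (X i : MvPowerSeries σ R) := by
  classical
  ext m
  rw [coeff_pderiv, coeff_subst_X, coeff_subst_X, PowerSeries.coeff_derivative]
  simp [single_add]

theorem pderiv_subst_X_of_ne {i j : σ} (h : j ≠ i) (G : PowerSeries R) :
    pderiv R i (G.subst (X j : MvPowerSeries σ R)) = 0 := by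
  classical
  ext m
  rw [coeff_pderiv, coeff_subst_X, if_neg, zero_mul, map_zero]
  intro hm
  simpa [h] using DFunLike.congr_fun hm i

theorem finSuccEquiv_subst_X_zero {n : ℕ} (G : PowerSeries R) :
    finSuccEquiv R n (G.subst (X 0 : MvPowerSeries (Fin (n + 1)) R)) = PowerSeries.map C G := by
  ext i m
  rw [coeff_coeff_finSuccEquiv, coeff_subst_X, PowerSeries.coeff_map, coeff_C, cons_zero]
  refine if_congr ?_ rfl rfl
  rw [cons_eq_single_zero_iff]
  simp

theorem slice_subst_X_zero_mul (k : ℕ) (G : PowerSeries R) (V : MvPowerSeries (Fin 2) R) :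
    slice k (G.subst (X 0 : MvPowerSeries (Fin 2) R) * V) = G * slice k V := by
  ext i
  simp only [← coeff_coeff_finSuccEquiv_eq_coeff_slice, map_mul, finSuccEquiv_subst_X_zero,
    PowerSeries.coeff_mul, PowerSeries.coeff_map, map_sum, coeff_C_mul]

end SubstX

end Slices

section PlanarField

open MvPowerSeries

theorem divergence_planarField (G₁ G₂ : PowerSeries ℝ) :
    (planarField G₁ G₂).divergence =
      (PowerSeries.derivative ℝ G₂).subst coordU + 2 * G₁.subst coordU := by
  have h_two : pderiv ℝ (1 : Fin 2) (2 : MvPowerSeries (Fin 2) ℝ) = 0 := by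
    simpa using (pderiv ℝ (1 : Fin 2)).map_natCast 2
  simp [FormalVectorField.divergence, planarField, Derivation.leibniz, h_two,
    pderiv_subst_X_self, pderiv_subst_X_of_ne, mul_comm]

theorem slice_lieDerivative_planarField (G₁ G₂ : PowerSeries ℝ) (V : MvPowerSeries (Fin 2) ℝ)
    (k : ℕ) :
    slice k ((planarField G₁ G₂).lieDerivative V) =
      slice k (coordV * pderiv ℝ 0 V) + G₂ * PowerSeries.derivative ℝ (slice k V) +
        2 * (G₁ * (k * slice k V)) := by
  have h_expand : (planarField G₁ G₂).lieDerivative V =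
      coordV * pderiv ℝ 0 V + G₂.subst coordU * pderiv ℝ 0 V +
        2 * (G₁.subst coordU * (coordV * pderiv ℝ 1 V)) := by
    simp only [FormalVectorField.lieDerivative, planarField, Fin.sum_univ_two,
      Matrix.cons_val_zero, Matrix.cons_val_one]
    ring
  rw [h_expand]
  simp only [map_add, slice_subst_X_zero_mul, slice_pderiv_zero, slice_X_one_mul_pderiv_one,
    two_mul]

theorem slice_divergence_planarField_mul (G₁ G₂ : PowerSeries ℝ) (V : MvPowerSeries (Fin 2) ℝ)
    (k : ℕ) :
    slice k ((planarField G₁ G₂).divergence * V) =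
      PowerSeries.derivative ℝ G₂ * slice k V + 2 * (G₁ * slice k V) := by
  simp only [divergence_planarField, two_mul, add_mul, map_add, slice_subst_X_zero_mul]

theorem FormalVectorField.IsInverseIntegratingFactor.isSliceSolution {G₁ G₂ : PowerSeries ℝ}
    {V : MvPowerSeries (Fin 2) ℝ} (h : (planarField G₁ G₂).IsInverseIntegratingFactor V) :
    IsSliceSolution (2 * (PowerSeries.X * G₁)) G₂ fun k => slice k V := by
  have h_slice (k : ℕ) := congrArg (slice k) h
  simp only [slice_lieDerivative_planarField, slice_divergence_planarField_mul] at h_slice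
  constructor
  · have h_zero := h_slice 0
    rw [slice_zero_X_one_mul, Nat.cast_zero] at h_zero
    simp only [eulerWronskian, eulerDerivation_apply]
    linear_combination PowerSeries.X * h_zero
  · intro k
    have h_succ := h_slice (k + 1)
    rw [slice_succ_X_one_mul, slice_pderiv_zero, Nat.cast_succ] at h_succ
    simp only [eulerWronskian, eulerDerivation_apply]
    linear_combination PowerSeries.X * h_succ

namespace HasLeadingTermV

variable {V : MvPowerSeries (Fin 2) ℝ}

theorem coeff_eq (hV : HasLeadingTermV V) {m : Fin 2 →₀ ℕ} (hm : m.degree < 2) :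
    coeff m V = coeff m coordV := by
  have := coeff_of_lt_order (lt_of_lt_of_le (by exact_mod_cast hm) hV)
  rwa [map_sub, sub_eq_zero] at this

theorem constantCoeff_eq_zero (hV : HasLeadingTermV V) : constantCoeff V = 0 := by
  rw [← coeff_zero_eq_constantCoeff_apply, hV.coeff_eq (by simp)]
  simp

theorem coeff_single_one_ne_zero (hV : HasLeadingTermV V) :
    coeff (Finsupp.single 1 1) V ≠ 0 := by
  rw [hV.coeff_eq (by simp), coeff_index_single_self_X]
  exact one_ne_zero

end HasLeadingTermV

theorem mainTheorem8_general {G₁ G₂ : PowerSeries ℝ} {V : MvPowerSeries (Fin 2) ℝ}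
    (hG₂ : PowerSeries.coeff 0 G₂ = 0) (hG : G₁ * G₂ ≠ 0) (hV : constantCoeff V = 0)
    (h : (planarField G₁ G₂).IsInverseIntegratingFactor V) :
    coeff (Finsupp.single 1 1) V = 0 := by
  have h_two : (2 : PowerSeries ℝ) ≠ 0 := fun h₂ => by
    simpa only [map_ofNat, map_zero, two_ne_zero] using congrArg PowerSeries.constantCoeff h₂
  have hA : 2 * (PowerSeries.X * G₁) ≠ 0 :=
    mul_ne_zero h_two (mul_ne_zero PowerSeries.X_ne_zero (left_ne_zero_of_mul hG))
  have h_slice_zero : PowerSeries.constantCoeff (slice 0 V) = 0 := by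
    rw [← PowerSeries.coeff_zero_eq_constantCoeff_apply, coeff_slice]
    simpa using hV
  have h_slice_one := h.isSliceSolution.constantCoeff_one_eq_zero hA (right_ne_zero_of_mul hG)
    (by simpa using hG₂) h_slice_zero
  rw [← PowerSeries.coeff_zero_eq_constantCoeff_apply, coeff_slice] at h_slice_one
  simpa using h_slice_one

end PlanarField

theorem mainTheorem8 (G₁ G₂ : PowerSeries ℝ)
    (hG₁ : PowerSeries.coeff 0 G₁ = 0)
    (hG₂₀ : PowerSeries.coeff 0 G₂ = 0) (hG₂₁ : PowerSeries.coeff 1 G₂ = 0)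
    (hG : G₁ * G₂ ≠ 0) :
    ¬ ∃ V : MvPowerSeries (Fin 2) ℝ,
      HasLeadingTermV V ∧ (planarField G₁ G₂).IsInverseIntegratingFactor V := by
  rintro ⟨V, hV, h⟩
  exact hV.coeff_single_one_ne_zero (mainTheorem8_general hG₂₀ hG hV.constantCoeff_eq_zero h)
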